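/- Let $\mathbf{A}$ be an abelian category. **Generalized morphisms.** A generalized morphism $\alpha\colon A\dashrightarrow B$ is a span $A\xleftarrow{\lambda}C\xrightarrow{\rho}B$; two spans are regarded as equal if the images of $(\lambda,\rho)\colon C\to A\oplus B$ agree as subobjects. Spans are composed by pullback (written $\alpha\cdot\beta$, first $\alpha$, then $\beta$), the pseudo-inverse $\alpha^{-1}$ is the swapped span, and a morphism $f\colon A\to B$ yields $[f]=(A\xleftarrow{\mathrm{id}}A\xrightarrow{f}B)$. Put $$\mathrm{dom}(\alpha)=\mathrm{im}\,\lambda,\quad \mathrm{gker}(\alpha)=\lambda(\ker\rho)\ \subseteq A,\qquad \mathrm{gim}(\alpha)=\mathrm{im}\,\rho,\quad \mathrm{def}(\alpha)=\rho(\ker\lambda)\ \subseteq B .$$ For subobjects $S\subseteq T\subseteq X$ with $\iota\colon T\hookrightarrow X$ and $\epsilon\colon T\twoheadrightarrow T/S$, let $\mathrm{emb}=[\epsilon]^{-1}\cdot[\iota]\colon T/S\dashrightarrow X$ and $\mathrm{proj}=[\iota]^{-1}\cdot[\epsilon]\colon X\dashrightarrow T/S$. **Data.** Let $(M^\bullet,\partial^\bullet)$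 be a cochain complex in $\mathbf{A}$ indexed by $\mathbb{Z}$, where each $M^i$ carries a chain of subobjects $F^jM^i\supseteq F^{j+1}M^i$ ($j\in\mathbb{Z}$) such that $\partial^i$ restricts to $F^jM^i\to F^jM^{i+1}$ for all $i,j$. Put $G^{p,q}:=F^pM^{p+q}/F^{p+1}M^{p+q}$ and, for $r\ge 0$ and $p,q\in\mathbb{Z}$, $$\partial_r^{p,q}:=\mathrm{emb}\cdot[\partial^{p+q}]\cdot\mathrm{proj}\colon\ G^{p,q}\dashrightarrow M^{p+q}\to M^{p+q+1}\dashrightarrow G^{p+r,\,q-(r-1)} .$$ One has $\mathrm{def}(\partial_r^{p-r,q+(r-1)})\subseteq\mathrm{gim}(\partial_r^{p-r,q+(r-1)})\subseteq\mathrm{gker}(\partial_r^{p,q})\subseteq\mathrm{dom}(\partial_r^{p,q})$, and we put $$E_r^{p,q}:=\mathrm{dom}(\partial_r^{p,q})/\mathrm{def}(\partial_r^{p-r,\,q+(r-1)}) .$$ **Claim.** These objects form a cohomological spectral sequence starting at page $0$, with the differentials described below. In detail: 1. $\mathrm{dom}(\partial_0^{p,q})=G^{p,q}$ and $\mathrm{def}(\partial_0^{p,q-1})=0$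 for all $p,q$, so that $E_0^{p,q}$ is $G^{p,q}$. 2. For all $r\ge 0$ and $p,q\in\mathbb{Z}$ there is a morphism $d_r^{p,q}\colon E_r^{p,q}\to E_r^{p+r,\,q-(r-1)}$ in $\mathbf{A}$ such that $[d_r^{p,q}]$ is the composite $$E_r^{p,q}\overset{\mathrm{emb}}{\dashrightarrow}M^{p+q}\xrightarrow{\ \partial^{p+q}\ }M^{p+q+1}\overset{\mathrm{proj}}{\dashrightarrow}E_r^{p+r,\,q-(r-1)},$$ where $\mathrm{emb}$ and $\mathrm{proj}$ are the subquotient embedding and projection, taken through $G^{p,q}$ and $G^{p+r,q-(r-1)}$ respectively. It arises from $\partial_r^{p,q}$ by the generalized homomorphism theorem: there is an isomorphism $\widetilde{\partial}\colon\mathrm{dom}(\partial_r^{p,q})/\mathrm{gker}(\partial_r^{p,q})\to\mathrm{gim}(\partial_r^{p,q})/\mathrm{def}(\partial_r^{p,q})$ with $\partial_r^{p,q}=\mathrm{proj}\cdot[\widetilde{\partial}]\cdot\mathrm{emb}$, and $d_r^{p,q}$ is the composite $$E_r^{p,q}\twoheadrightarrow \frac{\mathrm{dom}(\partial_r^{p,q})}{\mathrm{gker}(\partial_r^{p,q})}\xrightarrow{\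 \widetilde{\partial}\ }\frac{\mathrm{gim}(\partial_r^{p,q})}{\mathrm{def}(\partial_r^{p,q})}\hookrightarrow E_r^{p+r,\,q-(r-1)} .$$ 3. $d_r^{p+r,\,q-(r-1)}\circ d_r^{p,q}=0$. 4. There are isomorphisms $E_{r+1}^{p,q}\cong \ker(d_r^{p,q})/\mathrm{im}(d_r^{p-r,\,q+(r-1)})$, and they are compatible with the generalized embeddings of both sides into $G^{p,q}$ (the right-hand side being embedded as a subquotient of $E_r^{p,q}$). -/

import Mathlib

open CategoryTheory CategoryTheory.Limits

universe v u

/-- A generalized morphism from `A` to `B`: a span `A ⟵ apex ⟶ B`. Two generalized morphisms are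
regarded as equal when they are stably equivalent, see `GenMor.StableEquiv`. -/
structure GenMor {C : Type u} [Category.{v} C] (A B : C) where
  /-- the apex of the span -/
  apex : C
  /-- the left leg -/
  l : apex ⟶ A
  /-- the right leg -/
  r : apex ⟶ B

namespace GenMor

section

variable {C : Type u} [Category.{v} C]

/-- The generalized morphism `[f]` of a morphism `f`. -/
def ofHom {A B : C} (f : A ⟶ B) : GenMor A B := ⟨A, 𝟙 A, f⟩

/-- The pseudo-inverse. -/
def pinv {A B : C} (S : GenMor A B) : GenMor B A := ⟨S.apex, S.r, S.l⟩

/-- The generalized elements `a` of `A` and `b` of `B` are related by an element of the apex. -/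
def Related {A B : C} (S : GenMor A B) {W : C} (a : W ⟶ A) (b : W ⟶ B) : Prop :=
  ∃ w : W ⟶ S.apex, w ≫ S.l = a ∧ w ≫ S.r = b

theorem related_self {A B : C} (S : GenMor A B) : S.Related S.l S.r :=
  ⟨𝟙 _, Category.id_comp _, Category.id_comp _⟩

theorem related_ofHom {A B : C} (f : A ⟶ B) {W : C} (a : W ⟶ A) (b : W ⟶ B) :
    (ofHom f).Related a b ↔ a ≫ f = b := by
  constructor
  · rintro ⟨w, rfl, rfl⟩
    exact Category.assoc _ _ _ |>.trans (congrArg (w ≫ ·) (Category.id_comp f))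
  · intro h
    exact ⟨a, Category.comp_id a, h⟩

theorem related_pinv {A B : C} (S : GenMor A B) {W : C} (a : W ⟶ A) (b : W ⟶ B) :
    S.pinv.Related b a ↔ S.Related a b :=
  ⟨fun ⟨w, h, h'⟩ => ⟨w, h', h⟩, fun ⟨w, h, h'⟩ => ⟨w, h', h⟩⟩

end

section

variable {C : Type u} [Category.{v} C] [Abelian C]

/-- The associated relation of a span: the image of `(l, r) : apex ⟶ A ⊞ B`. -/
noncomputable def relation {A B : C} (S : GenMor A B) : Subobject (A ⊞ B) :=
  imageSubobject (biprod.lift S.l S.r)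

/-- Equality of generalized morphisms: the associated relations agree as subobjects. -/
def StableEquiv {A B : C} (S T : GenMor A B) : Prop :=
  S.relation = T.relation

/-- Composition of spans by pullback (in diagrammatic order). -/
noncomputable def comp {A B D : C} (S : GenMor A B) (T : GenMor B D) : GenMor A D :=
  ⟨pullback S.r T.l, pullback.fst S.r T.l ≫ S.l, pullback.snd S.r T.l ≫ T.r⟩

/-- The domain `im l`. -/
noncomputable def dom {A B : C} (S : GenMor A B) : Subobject A :=
  imageSubobject S.l

/-- The generalized kernel `l (ker r)`. -/
noncomputable def gker {A B : C} (S : GenMor A B) : Subobject A :=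
  imageSubobject ((kernelSubobject S.r).arrow ≫ S.l)

/-- The generalized image `im r`. -/
noncomputable def gim {A B : C} (S : GenMor A B) : Subobject B :=
  imageSubobject S.r

/-- The defect `r (ker l)`. -/
noncomputable def defect {A B : C} (S : GenMor A B) : Subobject B :=
  imageSubobject ((kernelSubobject S.l).arrow ≫ S.r)

theorem gker_le_dom {A B : C} (S : GenMor A B) : S.gker ≤ S.dom :=
  imageSubobject_comp_le _ _

theorem defect_le_gim {A B : C} (S : GenMor A B) : S.defect ≤ S.gim :=
  imageSubobject_comp_le _ _

theorem related_comp {A B D : C} (S : GenMor A B) (T : GenMor B D) {W : C}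
    (a : W ⟶ A) (c : W ⟶ D) :
    (S.comp T).Related a c ↔ ∃ b : W ⟶ B, S.Related a b ∧ T.Related b c := by
  constructor
  · rintro ⟨w, rfl, rfl⟩
    change W ⟶ pullback S.r T.l at w
    refine ⟨(w ≫ pullback.fst _ _) ≫ S.r, ⟨w ≫ pullback.fst _ _, ?_, rfl⟩,
      ⟨w ≫ pullback.snd _ _, ?_, ?_⟩⟩
    · exact Category.assoc _ _ _
    · rw [Category.assoc, Category.assoc, pullback.condition]
    · exact Category.assoc _ _ _
  · rintro ⟨_, ⟨s, rfl, rfl⟩, ⟨t, h, rfl⟩⟩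
    refine ⟨pullback.lift s t h.symm, ?_, ?_⟩
    · exact (Category.assoc _ _ _).symm.trans (congrArg (· ≫ S.l) (pullback.lift_fst _ _ _))
    · exact (Category.assoc _ _ _).symm.trans (congrArg (· ≫ T.r) (pullback.lift_snd _ _ _))

theorem gim_le_gker {A B D : C} (S : GenMor A B) (T : GenMor B D)
    (h : ∀ {W : C} (a : W ⟶ A) (b : W ⟶ B), S.Related a b → T.Related b (0 : W ⟶ D)) :
    S.gim ≤ T.gker := by
  obtain ⟨f, hl, hr⟩ := h _ _ S.related_self
  unfold gim gker
  refine imageSubobject_le _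
    (factorThruKernelSubobject T.r f hr ≫
      factorThruImageSubobject ((kernelSubobject T.r).arrow ≫ T.l)) ?_
  rw [Category.assoc, imageSubobject_arrow_comp, ← Category.assoc,
    factorThruKernelSubobject_comp_arrow, hl]

end

end GenMor

namespace SubQuot

section

variable {C : Type u} [Category.{v} C] [Abelian C]

/-- The subquotient `T / S` of `X` for subobjects `S ≤ T` of `X`. -/
noncomputable def obj {X : C} {S T : Subobject X} (h : S ≤ T) : C :=
  cokernel (Subobject.ofLE S T h)

/-- The projection `T ↠ T / S`. -/
noncomputable def π {X : C} {S T : Subobject X} (h : S ≤ T) : (T : C) ⟶ obj h :=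
  cokernel.π (Subobject.ofLE S T h)

/-- The generalized subquotient embedding `T / S ↞ T ↪ X`. -/
noncomputable def emb {X : C} {S T : Subobject X} (h : S ≤ T) : GenMor (obj h) X :=
  (GenMor.ofHom (π h)).pinv.comp (GenMor.ofHom T.arrow)

/-- The generalized subquotient projection `X ↩ T ↠ T / S`. -/
noncomputable def proj {X : C} {S T : Subobject X} (h : S ≤ T) : GenMor X (obj h) :=
  (GenMor.ofHom T.arrow).pinv.comp (GenMor.ofHom (π h))

theorem related_emb {X : C} {S T : Subobject X} (h : S ≤ T) {W : C} (a : W ⟶ obj h)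
    (x : W ⟶ X) : (emb h).Related a x ↔ ∃ b : W ⟶ (T : C), b ≫ π h = a ∧ b ≫ T.arrow = x := by
  simp only [emb, GenMor.related_comp, GenMor.related_pinv, GenMor.related_ofHom]

theorem related_proj {X : C} {S T : Subobject X} (h : S ≤ T) {W : C} (x : W ⟶ X)
    (a : W ⟶ obj h) :
    (proj h).Related x a ↔ ∃ b : W ⟶ (T : C), b ≫ T.arrow = x ∧ b ≫ π h = a := by
  simp only [proj, GenMor.related_comp, GenMor.related_pinv, GenMor.related_ofHom]

/-- The morphism `T / S ⟶ T' / S'` induced by inclusions `T ≤ T'` and `S ≤ S'`. -/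
noncomputable def map {X : C} {S T S' T' : Subobject X} (h : S ≤ T) (h' : S' ≤ T')
    (hS : S ≤ S') (hT : T ≤ T') : obj h ⟶ obj h' :=
  cokernel.map _ _ (Subobject.ofLE S S' hS) (Subobject.ofLE T T' hT) (by simp)

end

end SubQuot

/-- A filtered cochain complex: a `ℤ`-indexed cochain complex `M` each of whose objects carries a
descending `ℤ`-indexed chain of subobjects, compatible with the differentials. -/
structure FilteredCochainComplex (C : Type u) [Category.{v} C] [Abelian C] where
  /-- the underlying cochain complex -/
  M : CochainComplex C ℤ
  /-- `F j i` is the `j`-th step of the filtration of `M.X i` -/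
  F : ℤ → ∀ i : ℤ, Subobject (M.X i)
  le_succ : ∀ j i : ℤ, F (j + 1) i ≤ F j i
  compat : ∀ j i : ℤ, (F j (i + 1)).Factors ((F j i).arrow ≫ M.d i (i + 1))

namespace FilteredCochainComplex

section

variable {C : Type u} [Category.{v} C] [Abelian C] (K : FilteredCochainComplex C)

/-- The graded part `F^p M^{p+q} / F^{p+1} M^{p+q}`. -/
noncomputable abbrev gr (p q : ℤ) : C := SubQuot.obj (K.le_succ p (p + q))

/-- The generalized subquotient embedding of `gr p q` into `M^{p+q}`. -/
noncomputable def emb (p q : ℤ) : GenMor (K.gr p q) (K.M.X (p + q)) :=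
  SubQuot.emb (K.le_succ p (p + q))

/-- The generalized subquotient projection of `M^{p+q}` onto `gr p q`. -/
noncomputable def proj (p q : ℤ) : GenMor (K.M.X (p + q)) (K.gr p q) :=
  SubQuot.proj (K.le_succ p (p + q))

/-- The generalized morphism `emb · [∂] · proj` from `gr p q` to `gr p' q'`, for total degrees
with `p' + q' = p + q + 1`. Source and target are kept independent here, so that no transport
along equations between indices is needed. -/
noncomputable def genD (p q p' q' : ℤ) : GenMor (K.gr p q) (K.gr p' q') :=
  ((K.emb p q).comp (GenMor.ofHom (K.M.d (p + q) (p' + q')))).comp (K.proj p' q')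

/-- The generalized differential `∂_r^{p,q}`, going out of position `(p, q)`. -/
noncomputable def del (r p q : ℤ) : GenMor (K.gr p q) (K.gr (p + r) (q - (r - 1))) :=
  K.genD p q (p + r) (q - (r - 1))

/-- The generalized differential `∂_r^{p-r,q+(r-1)}`, going into position `(p, q)`. -/
noncomputable def delIn (r p q : ℤ) : GenMor (K.gr (p - r) (q + (r - 1))) (K.gr p q) :=
  K.genD (p - r) (q + (r - 1)) p q

/-- Consecutive generalized differentials form a generalized cochain complex. -/
theorem gim_genD_le_gker_genD (p q p' q' p'' q'' : ℤ) :
    (K.genD p q p' q').gim ≤ (K.genD p' q' p'' q'').gker := by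
  refine GenMor.gim_le_gker _ _ fun _ _ h => ?_
  obtain ⟨_, h₁, h₂⟩ := (GenMor.related_comp _ _ _ _).1 h
  obtain ⟨a, -, h₁⟩ := (GenMor.related_comp _ _ _ _).1 h₁
  obtain rfl := (GenMor.related_ofHom _ _ _).1 h₁
  rw [proj, SubQuot.related_proj] at h₂
  obtain ⟨b, hb, hbr⟩ := h₂
  refine (GenMor.related_comp _ _ _ _).2 ⟨0, (GenMor.related_comp _ _ _ _).2
    ⟨b ≫ (K.F p' (p' + q')).arrow, (SubQuot.related_emb _ _ _).2 ⟨b, hbr, rfl⟩,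
      (GenMor.related_ofHom _ _ _).2 ?_⟩, (SubQuot.related_proj _ _ _).2 ⟨0, zero_comp, zero_comp⟩⟩
  rw [hb, Category.assoc, K.M.d_comp_d, comp_zero]

theorem delIn_gim_le_del_gker (r p q : ℤ) : (K.delIn r p q).gim ≤ (K.del r p q).gker :=
  K.gim_genD_le_gker_genD _ _ _ _ _ _

theorem delIn_defect_le_del_gker (r p q : ℤ) : (K.delIn r p q).defect ≤ (K.del r p q).gker :=
  (K.delIn r p q).defect_le_gim.trans (K.delIn_gim_le_del_gker r p q)

theorem delIn_defect_le_del_dom (r p q : ℤ) : (K.delIn r p q).defect ≤ (K.del r p q).dom :=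
  (K.delIn_defect_le_del_gker r p q).trans (K.del r p q).gker_le_dom

theorem genD_defect_congr {p q p₁ q₁ : ℤ} (p' q' : ℤ) (hp : p = p₁) (hq : q = q₁) :
    (K.genD p q p' q').defect = (K.genD p₁ q₁ p' q').defect := by
  subst hp hq
  rfl

/-- The object `E_r^{p,q} = dom(∂_r^{p,q}) / def(∂_r^{p-r,q+(r-1)})`. -/
noncomputable abbrev page (r p q : ℤ) : C := SubQuot.obj (K.delIn_defect_le_del_dom r p q)

/-- `E_r^{p,q}` as a generalized subobject of `gr p q`. -/
noncomputable def pageEmbGr (r p q : ℤ) : GenMor (K.page r p q) (K.gr p q) :=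
  SubQuot.emb (K.delIn_defect_le_del_dom r p q)

/-- The generalized subquotient projection of `gr p q` onto `E_r^{p,q}`. -/
noncomputable def pageProjGr (r p q : ℤ) : GenMor (K.gr p q) (K.page r p q) :=
  SubQuot.proj (K.delIn_defect_le_del_dom r p q)

/-- The generalized subquotient embedding of `E_r^{p,q}` into `M^{p+q}`. -/
noncomputable def pageEmb (r p q : ℤ) : GenMor (K.page r p q) (K.M.X (p + q)) :=
  (K.pageEmbGr r p q).comp (K.emb p q)

/-- The generalized subquotient projection of `M^{p+q}` onto `E_r^{p,q}`. -/
noncomputable def pageProj (r p q : ℤ) : GenMor (K.M.X (p + q)) (K.page r p q) :=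
  (K.proj p q).comp (K.pageProjGr r p q)

/-- The projection `E_r^{p,q} ↠ dom(∂_r^{p,q}) / gker(∂_r^{p,q})`. -/
noncomputable def pageToCoim (r p q : ℤ) :
    K.page r p q ⟶ SubQuot.obj (K.del r p q).gker_le_dom :=
  SubQuot.map _ _ (K.delIn_defect_le_del_gker r p q) le_rfl

/-- The inclusion `gim(∂_r^{p,q}) / def(∂_r^{p,q}) ↪ E_r^{p+r,q-(r-1)}`. -/
noncomputable def imToPage (r p q : ℤ) :
    SubQuot.obj (K.del r p q).defect_le_gim ⟶ K.page r (p + r) (q - (r - 1)) :=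
  SubQuot.map _ _ (K.genD_defect_congr _ _ (by ring) (by ring)).le
    ((K.gim_genD_le_gker_genD _ _ _ _ _ _).trans (GenMor.gker_le_dom _))

/-- The generalized morphism `emb · [∂] · proj` from `E_r^{p,q}` to `E_r^{p+r,q-(r-1)}`. -/
noncomputable def pageDel (r p q : ℤ) :
    GenMor (K.page r p q) (K.page r (p + r) (q - (r - 1))) :=
  ((K.pageEmb r p q).comp (GenMor.ofHom (K.M.d (p + q) (p + r + (q - (r - 1)))))).comp
    (K.pageProj r (p + r) (q - (r - 1)))

end

end FilteredCochainComplex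

/-- The homology of a complex as a generalized subobject `H ↞ Z ↪ X` of its objects. -/
noncomputable def homologyEmb {C : Type u} [Category.{v} C] [Abelian C] {κ : Type*}
    {c : ComplexShape κ} (P : HomologicalComplex C c) (k : κ) : GenMor (P.homology k) (P.X k) :=
  (GenMor.ofHom (P.homologyπ k)).pinv.comp (GenMor.ofHom (P.iCycles k))

/-! Everything is computed with elements `W ⟶ X`, up to epimorphic covers of `W`. A span becomes the
relation "locally related", and stable equivalence says that two spans define the same relation
(`GenMor.stableEquiv_iff`).

In these terms `∂_r` relates the class of `x ∈ F^p` to the class of `y ∈ F^{p+r}` when `∂x = y`. So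
its domain consists of the classes of `x` with `∂x ∈ F^{p+r}`, and its generalized kernel of those
with `∂x ∈ F^{p+r+1}`. Its generalized image consists of the classes of `y = ∂x` with `x ∈ F^p`, and
its defect of those with `x ∈ F^{p+1}`. Hence gker of `∂_r` is dom of `∂_{r+1}`, and the gim
arriving at `(p, q)` for `r` is the defect arriving there for `r + 1` (`genD_gker_eq_dom`,
`genD_gim_eq_defect`).

The generalized homomorphism theorem gives `dom/gker ≅ gim/def`, and `d_r` is this isomorphism
between a quotient of the source and a subobject of the target. Inside `E_r = dom/def` its kernel is
`gker/def` and the incoming image is `gim/def`. The homology is therefore `gker/gim`, which is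
`dom/def` for `r + 1`. No boundedness of the filtration is needed. -/

section Subobjects

/-! ### Subobjects tested on generalized elements -/

theorem Subobject.le_of_forall_factors {C : Type u} [Category.{v} C] {X : C} {S T : Subobject X}
    (h : ∀ (W : C) (x : W ⟶ X), S.Factors x → T.Factors x) : S ≤ T :=
  Subobject.le_of_comm (T.factorThru _ (h _ _ S.factors_self)) (by simp)

theorem Subobject.eq_of_forall_factors_iff {C : Type u} [Category.{v} C] {X : C} {S T : Subobject X}
    (h : ∀ (W : C) (x : W ⟶ X), S.Factors x ↔ T.Factors x) : S = T :=
  le_antisymm (le_of_forall_factors fun W x => (h W x).1)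
    (le_of_forall_factors fun W x => (h W x).2)

variable {C : Type u} [Category.{v} C] [Abelian C]

theorem imageSubobject_factors_iff {X Y W : C} (f : X ⟶ Y) (y : W ⟶ Y) :
    (imageSubobject f).Factors y ↔
      ∃ (W' : C) (π : W' ⟶ W) (_ : Epi π) (x : W' ⟶ X), π ≫ y = x ≫ f := by
  constructor
  · intro h
    obtain ⟨W', π, hπ, x, hx⟩ := surjective_up_to_refinements_of_epi
      (factorThruImageSubobject f) ((imageSubobject f).factorThru y h)
    refine ⟨W', π, hπ, x, ?_⟩
    have := congrArg (· ≫ (imageSubobject f).arrow) hx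
    simpa using this
  · rintro ⟨W', π, hπ, x, hx⟩
    -- Epimorphisms are strong here, so membership in a subobject descends along a cover.
    have sq : CommSq (x ≫ factorThruImageSubobject f) π (imageSubobject f).arrow y :=
      ⟨by simp [hx]⟩
    have := strongEpi_of_epi π
    exact (Subobject.factors_iff _ _).2 ⟨sq.lift, sq.fac_right⟩

/-- Two quotients of an object with the same kernel are isomorphic. -/
theorem exists_iso_of_comp_eq_zero_iff {Z A B : C} (f : Z ⟶ A) (g : Z ⟶ B) [Epi f] [Epi g]
    (h : ∀ (W : C) (z : W ⟶ Z), z ≫ f = 0 ↔ z ≫ g = 0) : ∃ t : A ≅ B, f ≫ t.hom = g := by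
  refine ⟨⟨Abelian.epiDesc f g ((h _ _).1 (kernel.condition f)),
    Abelian.epiDesc g f ((h _ _).2 (kernel.condition g)), ?_, ?_⟩, Abelian.comp_epiDesc _ _ _⟩
  · simp [← cancel_epi f]
  · simp [← cancel_epi g]

end Subobjects

/-! ### Generalized morphisms as local relations -/

namespace GenMor

theorem Related.precomp {C : Type u} [Category.{v} C] {A B : C} {S : GenMor A B}
    {W W' : C} {a : W ⟶ A} {b : W ⟶ B} (h : S.Related a b) (π : W' ⟶ W) : S.Related (π ≫ a) (π ≫ b) := by
  obtain ⟨w, rfl, rfl⟩ := h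
  exact ⟨π ≫ w, by simp, by simp⟩

/-- Two generalized elements are related by a generalized morphism after passing to an
epimorphic cover of their source. -/
def LocRelated {C : Type u} [Category.{v} C] {A B : C} (S : GenMor A B) {W : C}
    (a : W ⟶ A) (b : W ⟶ B) : Prop :=
  ∃ (W' : C) (π : W' ⟶ W) (_ : Epi π), S.Related (π ≫ a) (π ≫ b)

theorem Related.locRelated {C : Type u} [Category.{v} C] {A B : C} {S : GenMor A B}
    {W : C} {a : W ⟶ A} {b : W ⟶ B} (h : S.Related a b) : S.LocRelated a b :=
  ⟨W, 𝟙 W, inferInstance, h.precomp _⟩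

section

variable {C : Type u} [Category.{v} C] [Abelian C]

/-- An element of an image lifts to the apex only after a cover; this is why `LocRelated`, and not
`Related`, is invariant under stable equivalence. -/
theorem relation_factors_iff {A B : C} (S : GenMor A B) {W : C} (a : W ⟶ A) (b : W ⟶ B) :
    S.relation.Factors (biprod.lift a b) ↔ S.LocRelated a b := by
  rw [relation, imageSubobject_factors_iff]
  constructor
  · rintro ⟨W', π, hπ, w, h⟩
    have h1 := congrArg (· ≫ biprod.fst) h
    have h2 := congrArg (· ≫ biprod.snd) h
    simp only [Category.assoc, biprod.lift_fst, biprod.lift_snd] at h1 h2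
    exact ⟨W', π, hπ, w, h1.symm, h2.symm⟩
  · rintro ⟨W', π, hπ, w, h1, h2⟩
    refine ⟨W', π, hπ, w, ?_⟩
    ext <;> simp [h1, h2]

theorem stableEquiv_iff {A B : C} {S T : GenMor A B} :
    S.StableEquiv T ↔
      ∀ (W : C) (a : W ⟶ A) (b : W ⟶ B), S.LocRelated a b ↔ T.LocRelated a b := by
  constructor
  · intro h W a b
    rw [← relation_factors_iff, ← relation_factors_iff, h]
  · intro h
    refine Subobject.eq_of_forall_factors_iff fun W x => ?_
    have hx : x = biprod.lift (x ≫ biprod.fst) (x ≫ biprod.snd) := by ext <;> simp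
    rw [hx, relation_factors_iff, relation_factors_iff, h]

theorem stableEquiv_of_related_iff {A B : C} {S T : GenMor A B}
    (h : ∀ (W : C) (a : W ⟶ A) (b : W ⟶ B), S.Related a b ↔ T.Related a b) : S.StableEquiv T :=
  stableEquiv_iff.2 fun _ _ _ =>
    ⟨fun ⟨W', π, hπ, hs⟩ => ⟨W', π, hπ, (h _ _ _).1 hs⟩,
      fun ⟨W', π, hπ, hs⟩ => ⟨W', π, hπ, (h _ _ _).2 hs⟩⟩

theorem StableEquiv.trans {A B : C} {S T U : GenMor A B} (h : S.StableEquiv T)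
    (h' : T.StableEquiv U) : S.StableEquiv U :=
  Eq.trans h h'

theorem StableEquiv.symm {A B : C} {S T : GenMor A B} (h : S.StableEquiv T) : T.StableEquiv S :=
  Eq.symm h

theorem locRelated_comp {A B D : C} (S : GenMor A B) (T : GenMor B D) {W : C}
    (a : W ⟶ A) (c : W ⟶ D) :
    (S.comp T).LocRelated a c ↔ ∃ (W' : C) (π : W' ⟶ W) (_ : Epi π) (b : W' ⟶ B),
      S.LocRelated (π ≫ a) b ∧ T.LocRelated b (π ≫ c) := by
  constructor
  · rintro ⟨W', π, hπ, h⟩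
    obtain ⟨b, h1, h2⟩ := (related_comp _ _ _ _).1 h
    exact ⟨W', π, hπ, b, h1.locRelated, h2.locRelated⟩
  · rintro ⟨W', π, hπ, b, ⟨V, ρ, hρ, h1⟩, h2⟩
    obtain ⟨V', ρ', hρ', h2⟩ : T.LocRelated (ρ ≫ b) (ρ ≫ π ≫ c) := by
      obtain ⟨U, σ, hσ, h⟩ := h2
      -- The pullback of the two covers is a common refinement; its projection to the source of `ρ`
      -- is epi because `σ` is.
      exact ⟨pullback σ ρ, pullback.snd σ ρ, inferInstance, by
        simpa [pullback.condition_assoc] using h.precomp (pullback.fst σ ρ)⟩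
    have : Epi (ρ' ≫ ρ ≫ π) := inferInstance
    refine ⟨V', ρ' ≫ ρ ≫ π, this, (related_comp _ _ _ _).2 ⟨ρ' ≫ ρ ≫ b, ?_, ?_⟩⟩
    · simpa using h1.precomp ρ'
    · simpa using h2

theorem StableEquiv.comp {A B D : C} {S S' : GenMor A B} {T T' : GenMor B D}
    (hS : S.StableEquiv S') (hT : T.StableEquiv T') : (S.comp T).StableEquiv (S'.comp T') := by
  rw [stableEquiv_iff] at *
  intro W a c
  simp only [locRelated_comp, hS, hT]

theorem refl_stableEquiv {A B : C} (S : GenMor A B) : S.StableEquiv S := Eq.refl _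

theorem dom_factors_iff {A B : C} (S : GenMor A B) {W : C} (a : W ⟶ A) :
    S.dom.Factors a ↔
      ∃ (W' : C) (π : W' ⟶ W) (_ : Epi π) (b : W' ⟶ B), S.Related (π ≫ a) b := by
  rw [dom, imageSubobject_factors_iff]
  constructor
  · rintro ⟨W', π, hπ, w, h⟩
    exact ⟨W', π, hπ, _, w, h.symm, rfl⟩
  · rintro ⟨W', π, hπ, b, w, h, -⟩
    exact ⟨W', π, hπ, w, h.symm⟩

theorem gker_factors_iff {A B : C} (S : GenMor A B) {W : C} (a : W ⟶ A) :
    S.gker.Factors a ↔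
      ∃ (W' : C) (π : W' ⟶ W) (_ : Epi π), S.Related (π ≫ a) 0 := by
  rw [gker, imageSubobject_factors_iff]
  constructor
  · rintro ⟨W', π, hπ, w, h⟩
    exact ⟨W', π, hπ, w ≫ (kernelSubobject S.r).arrow, by simp [h],
      by rw [Category.assoc, kernelSubobject_arrow_comp, comp_zero]⟩
  · rintro ⟨W', π, hπ, w, h, h0⟩
    exact ⟨W', π, hπ, factorThruKernelSubobject S.r w h0,
      by rw [← Category.assoc, factorThruKernelSubobject_comp_arrow, h]⟩

theorem gim_factors_iff {A B : C} (S : GenMor A B) {W : C} (b : W ⟶ B) :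
    S.gim.Factors b ↔
      ∃ (W' : C) (π : W' ⟶ W) (_ : Epi π) (a : W' ⟶ A), S.Related a (π ≫ b) := by
  -- By definition `S.gim` is `S.pinv.dom`; likewise the defect is the `gker` of `S.pinv`.
  refine (S.pinv.dom_factors_iff b).trans ?_
  simp only [related_pinv]

theorem defect_factors_iff {A B : C} (S : GenMor A B) {W : C} (b : W ⟶ B) :
    S.defect.Factors b ↔
      ∃ (W' : C) (π : W' ⟶ W) (_ : Epi π), S.Related 0 (π ≫ b) := by
  refine (S.pinv.gker_factors_iff b).trans ?_
  simp only [related_pinv]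

end

end GenMor

/-! ### Elements of subquotients -/

namespace SubQuot

section

variable {C : Type u} [Category.{v} C] [Abelian C]

instance epi_π {X : C} {S T : Subobject X} (h : S ≤ T) : Epi (π h) :=
  inferInstanceAs (Epi (cokernel.π _))

/-- In an abelian category the mono `S ⟶ T` is the kernel of its cokernel. -/
theorem comp_π_eq_zero_iff {X : C} {S T : Subobject X} (h : S ≤ T) {W : C} (b : W ⟶ (T : C)) :
    b ≫ π h = 0 ↔ S.Factors (b ≫ T.arrow) := by
  constructor
  · intro hb
    have hm : Abelian.monoLift (Subobject.ofLE S T h) b hb ≫ Subobject.ofLE S T h = b :=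
      Abelian.monoLift_comp _ _ _
    rw [← hm, Category.assoc, Subobject.ofLE_arrow]
    exact Subobject.factors_comp_arrow _
  · intro hb
    have : b = S.factorThru _ hb ≫ Subobject.ofLE S T h := by simp [← cancel_mono T.arrow]
    rw [this, Category.assoc]
    exact (congrArg (_ ≫ ·) (cokernel.condition _)).trans comp_zero

theorem π_map {X : C} {S T S' T' : Subobject X} (h : S ≤ T) (h' : S' ≤ T')
    (hS : S ≤ S') (hT : T ≤ T') : π h ≫ map h h' hS hT = Subobject.ofLE T T' hT ≫ π h' :=
  cokernel.π_desc _ _ _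

instance epi_map {X : C} {S T S' : Subobject X} (h : S ≤ T) (h' : S' ≤ T)
    (hS : S ≤ S') (hT : T ≤ T) : Epi (map h h' hS hT) := by
  have : π h ≫ map h h' hS hT = π h' := by rw [π_map]; simp
  exact epi_of_epi_fac this

/-- An element dying in `T'/S'` lifts locally to `T` and lies in `S' ≤ S`. The hypotheses force `S =
S'`, but allow the two to be only propositionally equal. -/
theorem mono_map {X : C} {S T T' : Subobject X} (h : S ≤ T) {S' : Subobject X} (h' : S' ≤ T')
    (hS : S ≤ S') (hT : T ≤ T') (hS' : S' ≤ S) : Mono (map h h' hS hT) := by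
  refine Preadditive.mono_of_cancel_zero _ fun {W} x hx => ?_
  obtain ⟨W', ρ, hρ, b, hb⟩ := surjective_up_to_refinements_of_epi (π h) x
  rw [← cancel_epi ρ, comp_zero, hb, comp_π_eq_zero_iff]
  have h0 : (b ≫ Subobject.ofLE T T' hT) ≫ π h' = 0 := by
    rw [Category.assoc, ← π_map h h' hS hT, ← Category.assoc, ← hb, Category.assoc, hx, comp_zero]
  rw [comp_π_eq_zero_iff] at h0
  exact Subobject.factors_of_le _ hS' (by simpa using h0)

end

end SubQuot

/-! ### The generalized homomorphism theorem -/

namespace GenMor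

section

variable {C : Type u} [Category.{v} C] [Abelian C]

/-- The generalized homomorphism theorem. -/
theorem exists_coimage_iso_image {A B : C} (S : GenMor A B) :
    ∃ t : SubQuot.obj S.gker_le_dom ≅ SubQuot.obj S.defect_le_gim,
      S.StableEquiv (((SubQuot.proj S.gker_le_dom).comp (ofHom t.hom)).comp
        (SubQuot.emb S.defect_le_gim)) := by
  let f : S.apex ⟶ (S.dom : C) := factorThruImageSubobject S.l
  let g : S.apex ⟶ (S.gim : C) := factorThruImageSubobject S.r
  have hf : f ≫ S.dom.arrow = S.l := imageSubobject_arrow_comp _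
  have hg : g ≫ S.gim.arrow = S.r := imageSubobject_arrow_comp _
  have : Epi f := inferInstanceAs (Epi (factorThruImageSubobject S.l))
  have : Epi g := inferInstanceAs (Epi (factorThruImageSubobject S.r))
  -- Both are quotients of the apex by `ker l + ker r`: if `w ∈ ker r` has the same left image as
  -- `z`, then `z - w` lies in `ker l` and has the same right image as `z`, and symmetrically.
  obtain ⟨t, ht⟩ := exists_iso_of_comp_eq_zero_iff (f ≫ SubQuot.π S.gker_le_dom)
    (g ≫ SubQuot.π S.defect_le_gim) fun W z => by
      rw [← Category.assoc, SubQuot.comp_π_eq_zero_iff, Category.assoc, hf, gker_factors_iff,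
        ← Category.assoc, SubQuot.comp_π_eq_zero_iff, Category.assoc, hg, defect_factors_iff]
      constructor
      · rintro ⟨W', ρ, hρ, w, h1, h2⟩
        exact ⟨W', ρ, hρ, ρ ≫ z - w, by simp [h1], by simp [h2]⟩
      · rintro ⟨W', ρ, hρ, w, h1, h2⟩
        exact ⟨W', ρ, hρ, ρ ≫ z - w, by simp [h1], by simp [h2]⟩
  refine ⟨t, stableEquiv_iff.2 fun W a b => ⟨?_, ?_⟩⟩
  · rintro ⟨W', ρ, hρ, w, h1, h2⟩
    refine ⟨W', ρ, hρ, (related_comp _ _ _ _).2 ⟨w ≫ g ≫ SubQuot.π _,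
      (related_comp _ _ _ _).2 ⟨w ≫ f ≫ SubQuot.π _,
        (SubQuot.related_proj _ _ _).2 ⟨w ≫ f, by simp [hf, h1], by simp⟩,
        (related_ofHom _ _ _).2 ?_⟩,
      (SubQuot.related_emb _ _ _).2 ⟨w ≫ g, by simp, by simp [hg, h2]⟩⟩⟩
    rw [← ht]
    simp
  · rintro ⟨W', ρ, hρ, h⟩
    obtain ⟨y, h1, h2⟩ := (related_comp _ _ _ _).1 h
    obtain ⟨x, h1, h3⟩ := (related_comp _ _ _ _).1 h1
    obtain ⟨c, hc, rfl⟩ := (SubQuot.related_proj _ _ _).1 h1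
    obtain ⟨e, he, he'⟩ := (SubQuot.related_emb _ _ _).1 h2
    obtain rfl := (related_ofHom _ _ _).1 h3
    -- A lift `w` of the left element to the apex has the correct right image only modulo the
    -- defect; a correction `k ∈ ker l` absorbs the error, and `w + k` witnesses the relation.
    obtain ⟨V, σ, hσ, w, hw⟩ := surjective_up_to_refinements_of_epi f c
    have h0 : (σ ≫ e - w ≫ g) ≫ SubQuot.π S.defect_le_gim = 0 := by
      rw [Preadditive.sub_comp, Category.assoc, Category.assoc, he, ← ht, ← Category.assoc σ,
        ← Category.assoc σ, hw]
      simp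
    rw [SubQuot.comp_π_eq_zero_iff, defect_factors_iff] at h0
    obtain ⟨V', τ, hτ, k, hk, hk'⟩ := h0
    have e1 : (τ ≫ w) ≫ S.l = (τ ≫ σ ≫ ρ) ≫ a := by
      rw [Category.assoc, Category.assoc, Category.assoc, ← hc, ← hf, ← Category.assoc w,
        ← Category.assoc σ, hw]
    have e2 : (τ ≫ w) ≫ S.r + k ≫ S.r = (τ ≫ σ ≫ ρ) ≫ b := by
      rw [hk']
      simp [hg, he']
    have : Epi (τ ≫ σ ≫ ρ) := inferInstance
    exact ⟨V', τ ≫ σ ≫ ρ, this, τ ≫ w + k, by rw [Preadditive.add_comp, e1, hk, add_zero],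
      by rw [Preadditive.add_comp, e2]⟩

/-- A generalized morphism that factors through `t : T / K ⟶ I / S'` restricts to an honest
morphism `T / S ⟶ T' / S'` of subquotients whenever `S ≤ K` and `I ≤ T'`. -/
theorem stableEquiv_emb_comp_proj {X Y : C} {S K T : Subobject X} {S' I T' S'' : Subobject Y}
    (h : S ≤ T) (hK : K ≤ T) (hSK : S ≤ K) (hTT : T ≤ T) (hI : S' ≤ I) (h' : S'' ≤ T')
    (hS' : S' ≤ S'') (hIT : I ≤ T')
    (t : SubQuot.obj hK ⟶ SubQuot.obj hI) :
    (((SubQuot.emb h).comp (((SubQuot.proj hK).comp (ofHom t)).comp (SubQuot.emb hI))).comp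
      (SubQuot.proj h')).StableEquiv
      (ofHom (SubQuot.map h hK hSK hTT ≫ t ≫ SubQuot.map hI h' hS' hIT)) := by
  have hπ : SubQuot.π h ≫ SubQuot.map h hK hSK hTT = SubQuot.π hK := by
    rw [SubQuot.π_map]; simp
  refine stableEquiv_iff.2 fun W a b => ⟨?_, ?_⟩
  · rintro ⟨W', ρ, hρ, hr⟩
    refine ⟨W', ρ, hρ, (related_ofHom _ _ _).2 ?_⟩
    obtain ⟨y, h1, h2⟩ := (related_comp _ _ _ _).1 hr
    obtain ⟨x, h1, h3⟩ := (related_comp _ _ _ _).1 h1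
    obtain ⟨i, h3, h4⟩ := (related_comp _ _ _ _).1 h3
    obtain ⟨k, h5, h6⟩ := (related_comp _ _ _ _).1 h3
    obtain rfl := (related_ofHom _ _ _).1 h6
    obtain ⟨u, hu, rfl⟩ := (SubQuot.related_emb _ _ _).1 h1
    obtain ⟨w, hw, rfl⟩ := (SubQuot.related_proj _ _ _).1 h5
    obtain ⟨z, hz, rfl⟩ := (SubQuot.related_emb _ _ _).1 h4
    obtain ⟨s, hs, hs'⟩ := (SubQuot.related_proj _ _ _).1 h2
    obtain rfl := (cancel_mono T.arrow).1 hw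
    have : s = z ≫ Subobject.ofLE I T' hIT := by simp [← cancel_mono T'.arrow, hs]
    rw [← hu, ← hs', Category.assoc, reassoc_of% hπ, ← Category.assoc, ← Category.assoc,
      Category.assoc, ← Category.assoc _ t, ← hz, Category.assoc, SubQuot.π_map, this,
      Category.assoc]
  · rintro ⟨W', ρ, hρ, hr⟩
    have hr := (related_ofHom _ _ _).1 hr
    -- The intermediate elements of the composite are a local lift `u ∈ T` of `a` and a local lift
    -- `z ∈ I` of the image of `u` under `t`.
    obtain ⟨V, σ, hσ, u, hu⟩ := surjective_up_to_refinements_of_epi (SubQuot.π h) (ρ ≫ a)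
    obtain ⟨V', τ, hτ, z, hz⟩ :=
      surjective_up_to_refinements_of_epi (SubQuot.π hI) (u ≫ SubQuot.π hK ≫ t)
    have : Epi (τ ≫ σ ≫ ρ) := inferInstance
    refine ⟨V', τ ≫ σ ≫ ρ, this, (related_comp _ _ _ _).2 ⟨z ≫ I.arrow, (related_comp _ _ _ _).2
      ⟨(τ ≫ u) ≫ T.arrow, (SubQuot.related_emb _ _ _).2 ⟨τ ≫ u, by simp [hu], rfl⟩,
        (related_comp _ _ _ _).2 ⟨(τ ≫ u) ≫ SubQuot.π hK ≫ t, (related_comp _ _ _ _).2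
          ⟨(τ ≫ u) ≫ SubQuot.π hK, (SubQuot.related_proj _ _ _).2 ⟨τ ≫ u, rfl, rfl⟩,
            (related_ofHom _ _ _).2 (by simp)⟩,
          (SubQuot.related_emb _ _ _).2 ⟨z, by simp [← hz], rfl⟩⟩⟩,
      (SubQuot.related_proj _ _ _).2 ⟨z ≫ Subobject.ofLE I T' hIT, by simp, ?_⟩⟩⟩
    rw [Category.assoc, ← SubQuot.π_map hI h' hS' hIT, ← reassoc_of% hz, Category.assoc,
      Category.assoc, ← hr, Category.assoc ρ, reassoc_of% hu, reassoc_of% hπ]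

end

end GenMor

/-! ### Homology of a complex of subquotients -/

section Homology

variable {C : Type u} [Category.{v} C] [Abelian C]

/-- If `P.X j` is the subquotient `T / S` of `X`, the kernel of the outgoing differential is
`T' / S` and the image of the incoming one is `S' / S`, then the homology at `j` is the subquotient
`T' / S'` of `X`. -/
theorem exists_homology_iso_subQuot {κ : Type*} {c : ComplexShape κ} (P : HomologicalComplex C c)
    {i j k : κ} (hi : c.prev j = i) (hk : c.next j = k) {X : C} {S T S' T' : Subobject X}
    (h : S ≤ T) (h' : S' ≤ T') (hT : T' ≤ T) (φ : P.X j ≅ SubQuot.obj h)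
    (hker : ∀ (W : C) (b : W ⟶ (T : C)),
      b ≫ SubQuot.π h ≫ φ.inv ≫ P.d j k = 0 ↔ T'.Factors (b ≫ T.arrow))
    (him : ∀ (W : C) (b : W ⟶ (T : C)),
      (∃ (W' : C) (ρ : W' ⟶ W) (_ : Epi ρ) (x : W' ⟶ P.X i),
        ρ ≫ b ≫ SubQuot.π h ≫ φ.inv = x ≫ P.d i j) ↔ S'.Factors (b ≫ T.arrow)) :
    ∃ ψ : P.homology j ≅ SubQuot.obj h',
      (((homologyEmb P j).comp (GenMor.ofHom φ.hom)).comp (SubQuot.emb h)).StableEquiv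
        ((GenMor.ofHom ψ.hom).comp (SubQuot.emb h')) := by
  let z : (T' : C) ⟶ P.cycles j :=
    P.liftCycles (Subobject.ofLE T' T hT ≫ SubQuot.π h ≫ φ.inv) k hk
    (by simpa using (hker _ (Subobject.ofLE T' T hT)).2 (by simp [T'.factors_self]))
  have hz : z ≫ P.iCycles j = Subobject.ofLE T' T hT ≫ SubQuot.π h ≫ φ.inv := by simp [z]
  -- A cycle lifts locally to `T`, and `hker` places the lift in `T'`.
  have hzepi : Epi z := by
    refine (epi_iff_surjective_up_to_refinements z).2 fun W y => ?_
    obtain ⟨W', ρ, hρ, b, hb⟩ :=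
      surjective_up_to_refinements_of_epi (SubQuot.π h) (y ≫ P.iCycles j ≫ φ.hom)
    have hb' : b ≫ SubQuot.π h ≫ φ.inv = ρ ≫ y ≫ P.iCycles j := by
      rw [← reassoc_of% hb]
      simp
    have hf : T'.Factors (b ≫ T.arrow) := by
      rw [← hker, reassoc_of% hb']
      simp
    refine ⟨W', ρ, hρ, T'.factorThru _ hf, ?_⟩
    have hfac : T'.factorThru _ hf ≫ Subobject.ofLE T' T hT = b := by simp [← cancel_mono T.arrow]
    rw [← cancel_mono (P.iCycles j), Category.assoc, Category.assoc, hz, ← hb',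
      reassoc_of% hfac]
  -- Two quotients of `T'` are compared: a cycle has zero homology class iff it is locally a
  -- boundary, which by `him` means that it comes from `S'`.
  obtain ⟨ψ, hψ⟩ := exists_iso_of_comp_eq_zero_iff (z ≫ P.homologyπ j) (SubQuot.π h')
    fun W x => by
      have hx : x ≫ T'.arrow = (x ≫ Subobject.ofLE T' T hT) ≫ T.arrow := by simp
      rw [SubQuot.comp_π_eq_zero_iff, hx, ← him, ← Category.assoc]
      refine (CokernelCofork.IsColimit.comp_π_eq_zero_iff_up_to_refinements
        (P.homologyIsCokernel i j hi) (x ≫ z)).trans ?_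
      refine exists_congr fun W' => exists_congr fun ρ => exists_congr fun _ =>
        exists_congr fun y => ?_
      rw [← cancel_mono (P.iCycles j)]
      simp [hz]
  refine ⟨ψ, GenMor.stableEquiv_of_related_iff fun W a x => ?_⟩
  simp only [GenMor.related_comp, GenMor.related_ofHom, SubQuot.related_emb, homologyEmb,
    GenMor.related_pinv]
  constructor
  · rintro ⟨_, ⟨_, ⟨y, rfl, rfl⟩, rfl⟩, b, hb, rfl⟩
    have hb' : b ≫ SubQuot.π h ≫ φ.inv = y ≫ P.iCycles j := by
      rw [reassoc_of% hb]
      simp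
    have hf : T'.Factors (b ≫ T.arrow) := by
      rw [← hker, reassoc_of% hb']
      simp
    refine ⟨_, rfl, T'.factorThru _ hf, ?_, by simp⟩
    have hfac : T'.factorThru _ hf ≫ Subobject.ofLE T' T hT = b := by simp [← cancel_mono T.arrow]
    have hy : T'.factorThru _ hf ≫ z = y := by
      rw [← cancel_mono (P.iCycles j), Category.assoc, hz, ← hb', reassoc_of% hfac]
    rw [← hψ, Category.assoc, Category.assoc, reassoc_of% hy]
  · rintro ⟨_, rfl, b, hb, rfl⟩
    refine ⟨_, ⟨_, ⟨b ≫ z, ?_, rfl⟩, rfl⟩, b ≫ Subobject.ofLE T' T hT, ?_, by simp⟩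
    · rw [← cancel_mono ψ.hom, ← hb, ← hψ]
      simp
    · rw [Category.assoc b z, hz]
      simp

end Homology

/-! ### The generalized differentials on elements of the filtration -/

namespace FilteredCochainComplex

section

variable {C : Type u} [Category.{v} C] [Abelian C] (K : FilteredCochainComplex C)

theorem factors_comp_d {i i' : ℤ} (h : i + 1 = i') (j : ℤ) {W : C} (x : W ⟶ K.M.X i)
    (hx : (K.F j i).Factors x) : (K.F j i').Factors (x ≫ K.M.d i i') := by
  subst h
  rw [← Subobject.factorThru_arrow _ x hx, Category.assoc]
  exact Subobject.factors_of_factors_right _ (K.compat j i)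

/-- Equal total degrees may fail to be definitionally equal, so the transport between the objects
`K.M.X k` is confined to this lemma and the next. -/
theorem factors_comp_d_congr (j i : ℤ) {k k' : ℤ} (h : k = k') {W : C} (x : W ⟶ K.M.X i) :
    (K.F j k).Factors (x ≫ K.M.d i k) ↔ (K.F j k').Factors (x ≫ K.M.d i k') := by
  subst h
  rfl

theorem exists_factors_comp_d_congr (j : ℤ) {i i' : ℤ} (h : i = i') (k : ℤ) {W : C}
    (y : W ⟶ K.M.X k) :
    (∃ x : W ⟶ K.M.X i, (K.F j i).Factors x ∧ x ≫ K.M.d i k = y) ↔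
      ∃ x : W ⟶ K.M.X i', (K.F j i').Factors x ∧ x ≫ K.M.d i' k = y := by
  subst h
  rfl

theorem related_genD (p q p' q' : ℤ) {W : C} (a : W ⟶ K.gr p q) (b : W ⟶ K.gr p' q') :
    (K.genD p q p' q').Related a b ↔
      ∃ (x : W ⟶ (K.F p (p + q) : C)) (y : W ⟶ (K.F p' (p' + q') : C)),
        x ≫ SubQuot.π (K.le_succ p (p + q)) = a ∧ y ≫ SubQuot.π (K.le_succ p' (p' + q')) = b ∧
        (x ≫ (K.F p (p + q)).arrow) ≫ K.M.d (p + q) (p' + q') =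
          y ≫ (K.F p' (p' + q')).arrow := by
  simp only [genD, emb, proj, GenMor.related_comp, SubQuot.related_emb, SubQuot.related_proj,
    GenMor.related_ofHom]
  constructor
  · rintro ⟨_, ⟨_, ⟨x, rfl, rfl⟩, rfl⟩, y, hy, rfl⟩
    exact ⟨x, y, rfl, rfl, hy.symm⟩
  · rintro ⟨x, y, rfl, rfl, h⟩
    exact ⟨_, ⟨_, ⟨x, rfl, rfl⟩, rfl⟩, y, h.symm, rfl⟩

theorem genD_dom_factors_iff (p q p' q' : ℤ) {W : C} (a : W ⟶ K.gr p q) :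
    (K.genD p q p' q').dom.Factors a ↔
      ∃ (W' : C) (ρ : W' ⟶ W) (_ : Epi ρ) (x : W' ⟶ (K.F p (p + q) : C)),
        x ≫ SubQuot.π (K.le_succ p (p + q)) = ρ ≫ a ∧
        (K.F p' (p' + q')).Factors
          ((x ≫ (K.F p (p + q)).arrow) ≫ K.M.d (p + q) (p' + q')) := by
  rw [GenMor.dom_factors_iff]
  refine exists_congr fun W' => exists_congr fun ρ => exists_congr fun _ => ?_
  simp only [related_genD]
  constructor
  · rintro ⟨_, x, y, hx, rfl, h⟩
    exact ⟨x, hx, h ▸ Subobject.factors_comp_arrow _⟩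
  · rintro ⟨x, hx, h⟩
    exact ⟨_, x, Subobject.factorThru _ _ h, hx, rfl, by simp⟩

theorem genD_gker_factors_iff (p q p' q' : ℤ) {W : C} (a : W ⟶ K.gr p q) :
    (K.genD p q p' q').gker.Factors a ↔
      ∃ (W' : C) (ρ : W' ⟶ W) (_ : Epi ρ) (x : W' ⟶ (K.F p (p + q) : C)),
        x ≫ SubQuot.π (K.le_succ p (p + q)) = ρ ≫ a ∧
        (K.F (p' + 1) (p' + q')).Factors
          ((x ≫ (K.F p (p + q)).arrow) ≫ K.M.d (p + q) (p' + q')) := by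
  rw [GenMor.gker_factors_iff]
  refine exists_congr fun W' => exists_congr fun ρ => exists_congr fun _ => ?_
  simp only [related_genD, SubQuot.comp_π_eq_zero_iff]
  constructor
  · rintro ⟨x, y, hx, hy, h⟩
    exact ⟨x, hx, h ▸ hy⟩
  · rintro ⟨x, hx, h⟩
    exact ⟨x, Subobject.factorThru _ _ (Subobject.factors_of_le _ (K.le_succ p' _) h), hx,
      by simpa using h, by simp⟩

/-- The preimage `x` is an element of `M` with a membership condition, so that image and defect
differ only in the filtration index `p` versus `p + 1`. -/
theorem genD_gim_factors_iff (p q p' q' : ℤ) {W : C} (b : W ⟶ K.gr p' q') :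
    (K.genD p q p' q').gim.Factors b ↔
      ∃ (W' : C) (ρ : W' ⟶ W) (_ : Epi ρ) (y : W' ⟶ (K.F p' (p' + q') : C)),
        y ≫ SubQuot.π (K.le_succ p' (p' + q')) = ρ ≫ b ∧
        ∃ x : W' ⟶ K.M.X (p + q), (K.F p (p + q)).Factors x ∧
          x ≫ K.M.d (p + q) (p' + q') = y ≫ (K.F p' (p' + q')).arrow := by
  rw [GenMor.gim_factors_iff]
  refine exists_congr fun W' => exists_congr fun ρ => exists_congr fun _ => ?_
  simp only [related_genD]
  constructor
  · rintro ⟨_, x, y, rfl, hy, h⟩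
    exact ⟨y, hy, _, Subobject.factors_comp_arrow _, h⟩
  · rintro ⟨y, hy, x, hx, h⟩
    exact ⟨_, Subobject.factorThru _ _ hx, y, rfl, hy, by simpa using h⟩

theorem genD_defect_factors_iff (p q p' q' : ℤ) {W : C} (b : W ⟶ K.gr p' q') :
    (K.genD p q p' q').defect.Factors b ↔
      ∃ (W' : C) (ρ : W' ⟶ W) (_ : Epi ρ) (y : W' ⟶ (K.F p' (p' + q') : C)),
        y ≫ SubQuot.π (K.le_succ p' (p' + q')) = ρ ≫ b ∧
        ∃ x : W' ⟶ K.M.X (p + q), (K.F (p + 1) (p + q)).Factors x ∧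
          x ≫ K.M.d (p + q) (p' + q') = y ≫ (K.F p' (p' + q')).arrow := by
  rw [GenMor.defect_factors_iff]
  refine exists_congr fun W' => exists_congr fun ρ => exists_congr fun _ => ?_
  simp only [related_genD, SubQuot.comp_π_eq_zero_iff]
  constructor
  · rintro ⟨x, y, hx, hy, h⟩
    exact ⟨y, hy, _, hx, h⟩
  · rintro ⟨y, hy, x, hx, h⟩
    exact ⟨Subobject.factorThru _ _ (Subobject.factors_of_le _ (K.le_succ p _) hx), y,
      by simpa using hx, hy, by simpa using h⟩

/-- Vanishing of `∂x` in the graded part at `p'` means that `∂x` lies one filtration step deeper,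
which is the domain condition for `p' + 1`. -/
theorem genD_gker_eq_dom (p q p' q' p'' q'' : ℤ) (hp : p'' = p' + 1)
    (h : p' + q' = p'' + q'') : (K.genD p q p' q').gker = (K.genD p q p'' q'').dom := by
  subst hp
  refine Subobject.eq_of_forall_factors_iff fun W a => ?_
  simp only [genD_gker_factors_iff, genD_dom_factors_iff, K.factors_comp_d_congr _ _ h]

/-- Dually, coming from `F^p` means coming from an element that vanishes in the graded part at `p₀ =
p - 1`. -/
theorem genD_gim_eq_defect (p q p₀ q₀ p' q' : ℤ) (hp : p = p₀ + 1)
    (h : p + q = p₀ + q₀) : (K.genD p q p' q').gim = (K.genD p₀ q₀ p' q').defect := by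
  subst hp
  refine Subobject.eq_of_forall_factors_iff fun W a => ?_
  simp only [genD_gim_factors_iff, genD_defect_factors_iff, K.exists_factors_comp_d_congr _ h]

/-- Since `∂` preserves `F^p`, every representative has its differential in `F^{p+0}`. -/
theorem del_zero_dom (p q : ℤ) : (K.del 0 p q).dom = ⊤ := by
  refine Subobject.eq_of_forall_factors_iff fun W a => iff_of_true ?_ (Subobject.top_factors _)
  obtain ⟨W', ρ, hρ, x, hx⟩ :=
    surjective_up_to_refinements_of_epi (SubQuot.π (K.le_succ p (p + q))) a
  have h := K.factors_comp_d (i' := p + 0 + (q - (0 - 1))) (by lia) p _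
    (Subobject.factors_comp_arrow x)
  exact (K.genD_dom_factors_iff _ _ _ _ _).2 ⟨W', ρ, hρ, x, hx.symm, by simpa using h⟩

/-- If `x ∈ F^{p+1}`, then `∂x ∈ F^{p+1}` as well, and its class is zero. -/
theorem delIn_zero_defect (p q : ℤ) : (K.delIn 0 p q).defect = ⊥ := by
  refine Subobject.eq_of_forall_factors_iff fun W b => ?_
  rw [Subobject.bot_factors_iff_zero]
  refine ⟨fun h => ?_, fun h => h ▸ Subobject.factors_zero⟩
  obtain ⟨W', ρ, hρ, y, hy, x, hx, hxy⟩ := (K.genD_defect_factors_iff _ _ _ _ _).1 h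
  have hd := K.factors_comp_d (i' := p + q) (by lia) _ x hx
  rw [hxy, sub_zero] at hd
  rw [← cancel_epi ρ, ← hy, comp_zero, SubQuot.comp_π_eq_zero_iff]
  exact hd

/-! ### The differentials of the pages -/

/-- The isomorphism of the generalized homomorphism theorem for the generalized morphism
`emb · [∂] · proj`. -/
noncomputable def genDIso (p q p' q' : ℤ) :
    SubQuot.obj (K.genD p q p' q').gker_le_dom ≅ SubQuot.obj (K.genD p q p' q').defect_le_gim :=
  (K.genD p q p' q').exists_coimage_iso_image.choose

theorem genD_stableEquiv (p q p' q' : ℤ) :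
    (K.genD p q p' q').StableEquiv
      (((SubQuot.proj (K.genD p q p' q').gker_le_dom).comp
        (GenMor.ofHom (K.genDIso p q p' q').hom)).comp
          (SubQuot.emb (K.genD p q p' q').defect_le_gim)) :=
  (K.genD p q p' q').exists_coimage_iso_image.choose_spec

/-- The target indices stay free, subject to equations, so that a single `pageD` serves both as
outgoing and as incoming differential: `p - r + r` is not definitionally `p`. -/
theorem del_dom_le (r p q : ℤ) {p' q' : ℤ} (hp : p + r = p') (hq : q - (r - 1) = q') :
    (K.del r p q).dom ≤ (K.genD p q p' q').dom := by
  subst hp hq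
  exact le_rfl

theorem gim_genD_le_del_dom (r p q p' q' : ℤ) :
    (K.genD p q p' q').gim ≤ (K.del r p' q').dom :=
  (K.gim_genD_le_gker_genD _ _ _ _ _ _).trans (GenMor.gker_le_dom _)

/-- The projection of `E_r^{p,q}` onto the coimage of the outgoing generalized differential. -/
noncomputable def pageToCoimage (r p q p' q' : ℤ) (hp : p + r = p') (hq : q - (r - 1) = q') :
    K.page r p q ⟶ SubQuot.obj (K.genD p q p' q').gker_le_dom :=
  SubQuot.map _ _ ((GenMor.defect_le_gim _).trans (K.gim_genD_le_gker_genD _ _ _ _ _ _))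
    (K.del_dom_le r p q hp hq)

/-- The inclusion of the image of the incoming generalized differential into `E_r^{p',q'}`. -/
noncomputable def imageToPage (r p q p' q' : ℤ) (hp : p + r = p') (hq : q - (r - 1) = q') :
    SubQuot.obj (K.genD p q p' q').defect_le_gim ⟶ K.page r p' q' :=
  SubQuot.map _ _ (K.genD_defect_congr _ _ (by lia) (by lia)).le
    (K.gim_genD_le_del_dom r p q p' q')

/-- The differential `E_r^{p,q} ⟶ E_r^{p',q'}` for `p' = p + r` and `q' = q - (r - 1)`. -/
noncomputable def pageD (r p q p' q' : ℤ) (hp : p + r = p') (hq : q - (r - 1) = q') :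
    K.page r p q ⟶ K.page r p' q' :=
  K.pageToCoimage r p q p' q' hp hq ≫ (K.genDIso p q p' q').hom ≫
    K.imageToPage r p q p' q' hp hq

theorem π_pageToCoimage (r p q p' q' : ℤ) (hp : p + r = p') (hq : q - (r - 1) = q') :
    SubQuot.π (K.delIn_defect_le_del_dom r p q) ≫ K.pageToCoimage r p q p' q' hp hq =
      Subobject.ofLE _ _ (K.del_dom_le r p q hp hq) ≫ SubQuot.π _ :=
  SubQuot.π_map _ _ _ _

theorem π_imageToPage (r p q p' q' : ℤ) (hp : p + r = p') (hq : q - (r - 1) = q') :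
    SubQuot.π (K.genD p q p' q').defect_le_gim ≫ K.imageToPage r p q p' q' hp hq =
      Subobject.ofLE _ _ (K.gim_genD_le_del_dom r p q p' q') ≫
        SubQuot.π (K.delIn_defect_le_del_dom r p' q') :=
  SubQuot.π_map _ _ _ _

instance epi_pageToCoimage (r p q p' q' : ℤ) (hp : p + r = p') (hq : q - (r - 1) = q') :
    Epi (K.pageToCoimage r p q p' q' hp hq) := by
  subst hp hq
  exact SubQuot.epi_map _ _ _ _

instance mono_imageToPage (r p q p' q' : ℤ) (hp : p + r = p') (hq : q - (r - 1) = q') :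
    Mono (K.imageToPage r p q p' q' hp hq) :=
  SubQuot.mono_map _ _ _ _ (K.genD_defect_congr _ _ (by lia) (by lia)).le

/-- After the projection to `dom/gker`, the differential is an isomorphism followed by a mono, so
only that projection kills anything. -/
theorem comp_π_pageD_eq_zero_iff (r p q p' q' : ℤ) (hp : p + r = p') (hq : q - (r - 1) = q')
    {W : C} (b : W ⟶ ((K.del r p q).dom : C)) :
    b ≫ SubQuot.π (K.delIn_defect_le_del_dom r p q) ≫ K.pageD r p q p' q' hp hq = 0 ↔
      (K.genD p q p' q').gker.Factors (b ≫ (K.del r p q).dom.arrow) := by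
  have h : b ≫ SubQuot.π (K.delIn_defect_le_del_dom r p q) ≫ K.pageD r p q p' q' hp hq =
      ((b ≫ Subobject.ofLE _ _ (K.del_dom_le r p q hp hq)) ≫ SubQuot.π _) ≫
        (K.genDIso p q p' q').hom ≫ K.imageToPage r p q p' q' hp hq := by
    rw [pageD, ← Category.assoc (SubQuot.π _), π_pageToCoimage]
    simp only [Category.assoc]
  rw [h]
  constructor
  · intro h0
    have := zero_of_comp_mono _ h0
    rw [SubQuot.comp_π_eq_zero_iff, Category.assoc, Subobject.ofLE_arrow] at this
    exact this
  · intro h0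
    have : (b ≫ Subobject.ofLE _ _ (K.del_dom_le r p q hp hq)) ≫
        SubQuot.π (K.genD p q p' q').gker_le_dom = 0 := by
      rw [SubQuot.comp_π_eq_zero_iff, Category.assoc, Subobject.ofLE_arrow]
      exact h0
    rw [this, zero_comp]

theorem exists_comp_pageD_iff (r p q p' q' : ℤ) (hp : p + r = p') (hq : q - (r - 1) = q')
    {W : C} (b : W ⟶ ((K.del r p' q').dom : C)) :
    (∃ (W' : C) (ρ : W' ⟶ W) (_ : Epi ρ) (x : W' ⟶ K.page r p q),
      ρ ≫ b ≫ SubQuot.π (K.delIn_defect_le_del_dom r p' q') = x ≫ K.pageD r p q p' q' hp hq) ↔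
      (K.genD p q p' q').gim.Factors (b ≫ (K.del r p' q').dom.arrow) := by
  have hle := K.gim_genD_le_del_dom r p q p' q'
  have hdef : (K.delIn r p' q').defect ≤ (K.genD p q p' q').gim :=
    (K.genD_defect_congr p' q' (by lia) (by lia)).le.trans (GenMor.defect_le_gim _)
  constructor
  · rintro ⟨W', ρ, hρ, x, hx⟩
    obtain ⟨V, σ, hσ, y, hy⟩ := surjective_up_to_refinements_of_epi
      (SubQuot.π (K.genD p q p' q').defect_le_gim)
      (x ≫ K.pageToCoimage r p q p' q' hp hq ≫ (K.genDIso p q p' q').hom)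
    -- Equality in the page determines `b` only modulo the incoming defect, which is contained in
    -- the image.
    have h0 : (σ ≫ ρ ≫ b - y ≫ Subobject.ofLE _ _ hle) ≫
        SubQuot.π (K.delIn_defect_le_del_dom r p' q') = 0 := by
      rw [Preadditive.sub_comp, Category.assoc, Category.assoc, Category.assoc, hx,
        ← K.π_imageToPage r p q p' q' hp hq, ← reassoc_of% hy, pageD, sub_self]
    rw [SubQuot.comp_π_eq_zero_iff] at h0
    have h1 := Subobject.factors_add _ (y ≫ (K.genD p q p' q').gim.arrow)
      (Subobject.factors_of_le _ hdef h0) (Subobject.factors_comp_arrow _)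
    rw [Preadditive.sub_comp, Category.assoc y, Subobject.ofLE_arrow, sub_add_cancel] at h1
    have sq : CommSq (Subobject.factorThru _ _ h1) (σ ≫ ρ) (K.genD p q p' q').gim.arrow
      (b ≫ (K.del r p' q').dom.arrow) := ⟨by simp⟩
    have := strongEpi_of_epi (σ ≫ ρ)
    exact (Subobject.factors_iff _ _).2 ⟨sq.lift, sq.fac_right⟩
  · intro h
    obtain ⟨W', ρ, hρ, x, hx⟩ := surjective_up_to_refinements_of_epi
      (K.pageToCoimage r p q p' q' hp hq ≫ (K.genDIso p q p' q').hom)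
      (Subobject.factorThru _ _ h ≫ SubQuot.π (K.genD p q p' q').defect_le_gim)
    refine ⟨W', ρ, hρ, x, ?_⟩
    have hb : b = Subobject.factorThru _ _ h ≫ Subobject.ofLE _ _ hle := by
      simp [← cancel_mono (K.del r p' q').dom.arrow]
    conv_lhs => rw [hb]
    rw [Category.assoc, ← K.π_imageToPage r p q p' q' hp hq, pageD, ← reassoc_of% hx]

/-- The first differential factors through `gim/def`, and `gim` is contained in the next `gker`. -/
theorem pageD_comp_pageD (r p q p' q' p'' q'' : ℤ) (hp : p + r = p') (hq : q - (r - 1) = q')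
    (hp' : p' + r = p'') (hq' : q' - (r - 1) = q'') :
    K.pageD r p q p' q' hp hq ≫ K.pageD r p' q' p'' q'' hp' hq' = 0 := by
  have h : K.imageToPage r p q p' q' hp hq ≫ K.pageD r p' q' p'' q'' hp' hq' = 0 := by
    rw [← cancel_epi (SubQuot.π (K.genD p q p' q').defect_le_gim), comp_zero, ← Category.assoc,
      π_imageToPage, Category.assoc]
    refine (K.comp_π_pageD_eq_zero_iff _ _ _ _ _ _ _ _).2 ?_
    rw [Subobject.ofLE_arrow]
    exact Subobject.factors_of_le _ (K.gim_genD_le_gker_genD _ _ _ _ _ _)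
      (Subobject.factors_self _)
  rw [pageD, Category.assoc, Category.assoc, h, comp_zero, comp_zero]

theorem pageD_stableEquiv (r p q : ℤ) :
    (GenMor.ofHom (K.pageD r p q (p + r) (q - (r - 1)) rfl rfl)).StableEquiv
      (K.pageDel r p q) := by
  -- The morphism is the restriction of `proj · [t] · emb` to the pages. Replacing this middle
  -- factor by `genD` and reassociating gives the composite through `M`.
  refine (GenMor.stableEquiv_emb_comp_proj _ _ _ _ _ _ _ _ _).symm.trans ?_
  refine (((GenMor.refl_stableEquiv _).comp (K.genD_stableEquiv _ _ _ _).symm).comp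
    (GenMor.refl_stableEquiv _)).trans ?_
  refine GenMor.stableEquiv_of_related_iff fun W a b => ?_
  simp only [genD, pageDel, pageEmb, pageProj, pageEmbGr, pageProjGr, GenMor.related_comp]
  constructor
  · rintro ⟨b, ⟨c, h1, d, ⟨e, h2, h3⟩, h4⟩, h5⟩
    exact ⟨d, ⟨e, ⟨c, h1, h2⟩, h3⟩, b, h4, h5⟩
  · rintro ⟨d, ⟨e, ⟨c, h1, h2⟩, h3⟩, b, h4, h5⟩
    exact ⟨b, ⟨c, h1, d, ⟨e, h2, h3⟩, h4⟩, h5⟩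

/-! ### Pages as complexes and the spectral sequence -/

/-- The page `E_r` as a complex. -/
noncomputable def pageComplex (r : ℤ) :
    HomologicalComplex C (ComplexShape.up' (⟨r, 1 - r⟩ : ℤ × ℤ)) where
  X i := K.page r i.1 i.2
  d i j := if h : i.1 + r = j.1 ∧ i.2 - (r - 1) = j.2 then
    K.pageD r i.1 i.2 j.1 j.2 h.1 h.2 else 0
  shape i j h := dif_neg fun h' => h (Prod.ext h'.1 (by
    have := h'.2
    simp only [Prod.snd_add]
    lia))
  d_comp_d' i j k _ _ := by
    split_ifs
    · exact K.pageD_comp_pageD _ _ _ _ _ _ _ _ _ _ _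
    all_goals simp

theorem pageComplex_d (r p q p' q' : ℤ) (hp : p + r = p') (hq : q - (r - 1) = q') :
    (K.pageComplex r).d (p, q) (p', q') = K.pageD r p q p' q' hp hq :=
  dif_pos ⟨hp, hq⟩

/-- Kernel and incoming image in `E_r` correspond to `gker` and `gim`, which are the domain and the
incoming defect for `r + 1`. The identity in the statement is what `eqToHom` becomes in the main
theorem. -/
theorem exists_homology_iso_page (r p q : ℤ) :
    ∃ ψ : (K.pageComplex r).homology (p, q) ≅ K.page (r + 1) p q,
      (((homologyEmb (K.pageComplex r) (p, q)).comp (GenMor.ofHom (𝟙 (K.page r p q)))).comp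
        (K.pageEmbGr r p q)).StableEquiv
          ((GenMor.ofHom ψ.hom).comp (K.pageEmbGr (r + 1) p q)) := by
  have hdom : (K.del r p q).gker = (K.del (r + 1) p q).dom :=
    K.genD_gker_eq_dom _ _ _ _ _ _ (by lia) (by lia)
  have hdef : (K.delIn r p q).gim = (K.delIn (r + 1) p q).defect :=
    K.genD_gim_eq_defect _ _ _ _ _ _ (by lia) (by lia)
  let φ : (K.pageComplex r).X (p, q) ≅ SubQuot.obj (K.delIn_defect_le_del_dom r p q) :=
    Iso.refl (K.page r p q)
  have hφ : φ.inv = 𝟙 (K.page r p q) := rfl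
  refine exists_homology_iso_subQuot (K.pageComplex r) (i := (p - r, q + (r - 1)))
    (k := (p + r, q - (r - 1))) ?_ ?_ (K.delIn_defect_le_del_dom r p q)
    (K.delIn_defect_le_del_dom (r + 1) p q) (hdom.symm.le.trans (K.del r p q).gker_le_dom) φ
    (fun W b => ?_) (fun W b => ?_)
  · exact ComplexShape.prev_eq' _ (Prod.ext (by simp) (by simp; lia))
  · exact ComplexShape.next_eq' _ (Prod.ext (by simp) (by simp; lia))
  · rw [K.pageComplex_d r p q _ _ rfl rfl, ← hdom]
    refine Iff.trans ?_ (K.comp_π_pageD_eq_zero_iff r p q _ _ rfl rfl b)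
    rw [hφ]
    erw [Category.id_comp]
    rfl
  · rw [K.pageComplex_d r _ _ p q (by lia) (by lia), ← hdef]
    refine Iff.trans ?_ (K.exists_comp_pageD_iff r _ _ p q (by lia) (by lia) b)
    rw [hφ]
    erw [Category.comp_id]
    rfl

/-- The spectral sequence of a filtered cochain complex. -/
noncomputable def spectralSequence : CohomologicalSpectralSequence C 0 where
  page r _ := K.pageComplex r
  iso r r' pq hrr' _ :=
    (K.exists_homology_iso_page r pq.1 pq.2).choose ≪≫
      eqToIso (by subst hrr'; rfl)

end

end FilteredCochainComplex

theorem mainTheorem8 {C : Type u} [Category.{v} C] [Abelian C] (K : FilteredCochainComplex C) :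
    -- the formula for `E_r^{p,q}` gives the graded part for `r = 0`
    (∀ p q : ℤ, (K.del 0 p q).dom = ⊤ ∧ (K.delIn 0 p q).defect = ⊥) ∧
    -- there is a cohomological spectral sequence starting at `0` with objects `E_r^{p,q}`
    ∃ (E : CohomologicalSpectralSequence C 0)
      (hX : ∀ (r : ℤ) (hr : 0 ≤ r) (p q : ℤ), (E.page r hr).X (p, q) = K.page r p q),
      ∀ (r : ℤ) (hr : 0 ≤ r) (p q : ℤ),
        -- its differential `d_r^{p,q}` is the generalized morphism `emb · [∂] · proj` ...
        GenMor.StableEquiv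
          (GenMor.ofHom (eqToHom (hX r hr p q).symm ≫
            (E.page r hr).d (p, q) (p + r, q - (r - 1)) ≫ eqToHom (hX r hr _ _)))
          (K.pageDel r p q) ∧
        -- ... and comes from `∂_r^{p,q}` by the generalized homomorphism theorem
        (∃ t : SubQuot.obj (K.del r p q).gker_le_dom ≅ SubQuot.obj (K.del r p q).defect_le_gim,
          GenMor.StableEquiv (K.del r p q)
            (((SubQuot.proj (K.del r p q).gker_le_dom).comp (GenMor.ofHom t.hom)).comp
              (SubQuot.emb (K.del r p q).defect_le_gim)) ∧
          eqToHom (hX r hr p q).symm ≫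
              (E.page r hr).d (p, q) (p + r, q - (r - 1)) ≫ eqToHom (hX r hr _ _) =
            K.pageToCoim r p q ≫ t.hom ≫ K.imToPage r p q) ∧
        -- the isomorphism `H(E_r) ≅ E_{r+1}` identifies them as subquotients of the graded part
        GenMor.StableEquiv
          (((homologyEmb (E.page r hr) (p, q)).comp
            (GenMor.ofHom (eqToHom (hX r hr p q)))).comp (K.pageEmbGr r p q))
          ((GenMor.ofHom ((E.iso r (r + 1) (p, q) rfl hr).hom ≫
            eqToHom (hX (r + 1) (by lia) p q))).comp (K.pageEmbGr (r + 1) p q)) := by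
  refine ⟨fun p q => ⟨K.del_zero_dom p q, K.delIn_zero_defect p q⟩, K.spectralSequence,
    fun _ _ _ _ => rfl, fun r hr p q => ?_⟩
  -- The objects of the pages are definitionally `K.page r p q`, so every `eqToHom` is an identity.
  have hd : eqToHom (rfl : K.page r p q = (K.spectralSequence.page r hr).X (p, q)) ≫
      (K.spectralSequence.page r hr).d (p, q) (p + r, q - (r - 1)) ≫
        eqToHom (rfl : _ = K.page r (p + r) (q - (r - 1))) =
      K.pageD r p q (p + r) (q - (r - 1)) rfl rfl :=
    (Category.id_comp _).trans ((Category.comp_id _).trans (K.pageComplex_d _ _ _ _ _ _ _))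
  have hi : (K.spectralSequence.iso r (r + 1) (p, q) rfl hr).hom ≫
      eqToHom (rfl : _ = K.page (r + 1) p q) = (K.exists_homology_iso_page r p q).choose.hom :=
    (Category.comp_id _).trans (Category.comp_id _)
  -- The isomorphism from which `pageD` was built is also the one factoring `K.del r p q`; at these
  -- indices `pageToCoimage` and `imageToPage` agree definitionally with `pageToCoim` and
  -- `imToPage`.
  refine ⟨?_, ⟨K.genDIso p q _ _, K.genD_stableEquiv p q _ _, hd⟩, ?_⟩
  · exact (congrArg (fun f => (GenMor.ofHom f).StableEquiv (K.pageDel r p q)) hd).mpr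
      (K.pageD_stableEquiv r p q)
  · exact (congrArg (fun f => (((homologyEmb (K.pageComplex r) (p, q)).comp
      (GenMor.ofHom (𝟙 (K.page r p q)))).comp (K.pageEmbGr r p q)).StableEquiv
        ((GenMor.ofHom f).comp (K.pageEmbGr (r + 1) p q))) hi).mpr
      (K.exists_homology_iso_page r p q).choose_spec
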